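/- Let $n\ge 2$ and $m\ge 0$ be integers. Let $\mathcal E'(\mathbb R^n)$ be the space of compactly supported (complex-valued) distributions on $\mathbb R^n$, i.e. the continuous dual of $C^\infty(\mathbb R^n)$. Let $\mathcal E'(S^p)$ be the space of compactly supported symmetric $p$-tensor field distributions, i.e. families $f=(f_{i_1\cdots i_p})_{1\le i_1,\dots,i_p\le n}$ of elements of $\mathcal E'(\mathbb R^n)$ that are invariant under permutations of the indices, and let $\mathcal E'(\mathbf S^m)=\bigoplus_{p=0}^m\mathcal E'(S^p)$, with elements $F=(f^{(0)},\dots,f^{(m)})$. For an integer $k\ge 0$, the $k$-th momentum ray transform of $F$ is the distribution $I^{m,k}F$ on $\mathbb R^n\times(\mathbb R^n\setminus\{0\})$ given, for $\Psi\in C_c^\infty(\mathbb R^n\times(\mathbb R^n\setminus\{0\}))$, by $$\langle I^{m,k}F,\Psi\rangle=\sum_{p=0}^m\ \sum_{i_1,\dots,i_p=1}^n\Big\langle f^{(p)}_{i_1\cdots i_p}\,,\ x\mapsto\int_{\mathbb R^n}\int_{\mathbb R}t^k\,\xi^{i_1}\cdots\xi^{i_p}\,\Psi(x-t\xi,\xi)\,dt\,d\xi\Big\rangle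 ;$$ for smooth compactly supported $F$ this is the function $I^{m,k}F(x,\xi)=\int_{\mathbb R}t^k\sum_{p=0}^m\sum_{i_1,\dots,i_p}f^{(p)}_{i_1\cdots i_p}(x+t\xi)\,\xi^{i_1}\cdots\xi^{i_p}\,dt$. Theorem. Let $F\in\mathcal E'(\mathbf S^m)$. If $I^{m,m}F=0$ on $\mathbb R^n\times(\mathbb R^n\setminus\{0\})$, then $F=0$. -/

import Mathlib

open scoped ContDiff

noncomputable section

namespace MomentumRay

/-- Euclidean space `ℝⁿ`. -/
abbrev Space (n : ℕ) : Type := EuclideanSpace ℝ (Fin n)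

/-- The space `C^∞(ℝⁿ)` of smooth complex-valued functions. -/
def SmoothFun (n : ℕ) : Submodule ℂ (Space n → ℂ) where
  carrier := {φ | ContDiff ℝ ∞ φ}
  zero_mem' := (contDiff_const : ContDiff ℝ ∞ fun _ : Space n => (0 : ℂ))
  add_mem' := fun {_ _} hφ hψ => ContDiff.add (𝕜 := ℝ) (n := ∞) hφ hψ
  smul_mem' := fun c _ hφ => ContDiff.const_smul (𝕜 := ℝ) (n := ∞) c hφ

/-- Continuity of a linear functional on `C^∞(ℝⁿ)` for its usual Fréchet topology: there are a
compact set `K`, an order `N` and a constant `C` such that `|T φ| ≤ C M` as soon as all derivatives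
of `φ` of order at most `N` are bounded by `M` on `K`. -/
def IsContinuousFunctional {n : ℕ} (T : SmoothFun n →ₗ[ℂ] ℂ) : Prop :=
  ∃ (K : Set (Space n)) (N : ℕ) (C : ℝ), IsCompact K ∧ 0 ≤ C ∧
    ∀ (φ : SmoothFun n) (M : ℝ), 0 ≤ M →
      (∀ j ≤ N, ∀ x ∈ K, ‖iteratedFDeriv ℝ j (φ : Space n → ℂ) x‖ ≤ M) → ‖T φ‖ ≤ C * M

/-- The space `𝓔'(ℝⁿ)` of compactly supported distributions, as the dual of `C^∞(ℝⁿ)`. -/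
def CompactDistribution (n : ℕ) : Submodule ℂ (SmoothFun n →ₗ[ℂ] ℂ) where
  carrier := {T | IsContinuousFunctional T}
  zero_mem' := ⟨∅, 0, 0, isCompact_empty, le_rfl, fun φ M _ _ => by simp⟩
  add_mem' := by
    rintro S T ⟨K, N, C, hK, hC, hS⟩ ⟨K', N', C', hK', hC', hT⟩
    refine ⟨K ∪ K', max N N', C + C', hK.union hK', add_nonneg hC hC', fun φ M hM h => ?_⟩
    have h1 := hS φ M hM fun j hj x hx => h j (hj.trans (le_max_left _ _)) x (Or.inl hx)
    have h2 := hT φ M hM fun j hj x hx => h j (hj.trans (le_max_right _ _)) x (Or.inr hx)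
    calc ‖(S + T) φ‖ ≤ ‖S φ‖ + ‖T φ‖ := norm_add_le _ _
      _ ≤ (C + C') * M := by linarith
  smul_mem' := by
    rintro c T ⟨K, N, C, hK, hC, hT⟩
    refine ⟨K, N, ‖c‖ * C, hK, mul_nonneg (norm_nonneg _) hC, fun φ M hM h => ?_⟩
    rw [LinearMap.smul_apply, norm_smul, mul_assoc]
    exact mul_le_mul_of_nonneg_left (hT φ M hM h) (norm_nonneg _)

/-- The space `𝓔'(S^p)` of compactly supported symmetric `p`-tensor field distributions: families
`f_{i₁…i_p}` of compactly supported distributions that are invariant under all permutations of the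
indices. -/
def SymTensorDistribution (n p : ℕ) : Submodule ℂ ((Fin p → Fin n) → CompactDistribution n) where
  carrier := {f | ∀ (σ : Equiv.Perm (Fin p)) (i : Fin p → Fin n), f (i ∘ σ) = f i}
  zero_mem' := fun _ _ => rfl
  add_mem' := fun hf hg σ i => by rw [Pi.add_apply, Pi.add_apply, hf σ i, hg σ i]
  smul_mem' := fun c f hf σ i => by rw [Pi.smul_apply, Pi.smul_apply, hf σ i]

/-- The space `𝓔'(𝐒^m) = 𝓔'(S^0) ⊕ 𝓔'(S^1) ⊕ ⋯ ⊕ 𝓔'(S^m)`; an element is the tuple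
`F = (f^(0), f^(1), …, f^(m))`. -/
abbrev MixedTensorDistribution (n m : ℕ) : Type :=
  (p : Fin (m + 1)) → SymTensorDistribution n p

/-- The open set `ℝⁿ × (ℝⁿ ∖ {0})`. -/
def PhaseSpace (n : ℕ) : TopologicalSpace.Opens (Space n × Space n) where
  carrier := {z | z.2 ≠ 0}
  is_open' := isOpen_ne_fun continuous_snd continuous_const

/-- The space `C_c^∞(ℝⁿ × (ℝⁿ ∖ {0}))` of complex-valued test functions. -/
abbrev PhaseTest (n : ℕ) : Type := TestFunction (PhaseSpace n) ℂ ⊤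

/-- The integrand `t^k ξ^{i₁} ⋯ ξ^{i_p} Ψ(x - tξ, ξ)`. -/
def adjointIntegrand {n p : ℕ} (k : ℕ) (i : Fin p → Fin n) (Ψ : PhaseTest n)
    (x : Space n) (ξ : Space n) (t : ℝ) : ℂ :=
  ((t ^ k * ∏ j, ξ (i j) : ℝ) : ℂ) * Ψ (x - t • ξ, ξ)

/-- The `(i₁,…,i_p)` component of the adjoint `(I^k)^* Ψ` as a function on `ℝⁿ`:
`x ↦ ∫_{ℝⁿ} ∫_ℝ t^k ξ^{i₁} ⋯ ξ^{i_p} Ψ(x - tξ, ξ) dt dξ`. -/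
def adjointFun {n p : ℕ} (k : ℕ) (i : Fin p → Fin n) (Ψ : PhaseTest n) (x : Space n) : ℂ :=
  ∫ ξ : Space n, ∫ t : ℝ, adjointIntegrand k i Ψ x ξ t

theorem contDiff_adjointIntegrand {n p : ℕ} (k : ℕ) (i : Fin p → Fin n) (Ψ : PhaseTest n) :
    ContDiff ℝ ∞ (fun q : Space n × (Space n × ℝ) => adjointIntegrand k i Ψ q.1 q.2.1 q.2.2) := by
  have hΨ : ContDiff ℝ ∞ (Ψ : Space n × Space n → ℂ) := Ψ.contDiff
  have hcoord : ∀ j : Fin p,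
      ContDiff ℝ ∞ (fun q : Space n × (Space n × ℝ) => q.2.1 (i j)) := fun j =>
    (EuclideanSpace.proj (i j) : Space n →L[ℝ] ℝ).contDiff.comp
      (contDiff_fst.comp contDiff_snd)
  have h1 : ContDiff ℝ ∞ (fun q : Space n × (Space n × ℝ) =>
      q.2.2 ^ k * ∏ j, q.2.1 (i j)) :=
    ((contDiff_snd.comp contDiff_snd).pow k).mul (contDiff_prod fun j _ => hcoord j)
  have h2 : ContDiff ℝ ∞ (fun q : Space n × (Space n × ℝ) =>
      Ψ (q.1 - q.2.2 • q.2.1, q.2.1)) :=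
    hΨ.comp (by fun_prop)
  exact (Complex.ofRealCLM.contDiff.comp h1).mul h2

/-- For `x` in a bounded set, the integrand is supported in a fixed compact set of pairs `(ξ, t)`. -/
theorem exists_compact_adjointIntegrand {n p : ℕ} (k : ℕ) (i : Fin p → Fin n) (Ψ : PhaseTest n)
    (R : ℝ) : ∃ K : Set (Space n × ℝ), IsCompact K ∧
      ∀ x ∈ Metric.ball (0 : Space n) R, ∀ z : Space n × ℝ, z ∉ K →
        adjointIntegrand k i Ψ x z.1 z.2 = 0 := by
  let g : Space n × (Space n × Space n) → Space n × ℝ :=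
    fun w => (w.2.2, inner ℝ (w.1 - w.2.1) w.2.2 / ‖w.2.2‖ ^ 2)
  refine ⟨g '' (Metric.closedBall (0 : Space n) R ×ˢ tsupport Ψ), ?_, ?_⟩
  · refine ((isCompact_closedBall (0 : Space n) R).prod Ψ.hasCompactSupport).image_of_continuousOn ?_
    refine ContinuousOn.prodMk (by fun_prop) (ContinuousOn.div (by fun_prop) (by fun_prop) ?_)
    intro w hw
    have hne : w.2.2 ≠ 0 := Ψ.tsupport_subset hw.2
    exact pow_ne_zero _ (norm_ne_zero_iff.2 hne)
  · intro x hx z hz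
    by_contra hne
    apply hz
    have hΨ : Ψ (x - z.2 • z.1, z.1) ≠ 0 := fun h => hne (by simp [adjointIntegrand, h])
    have hmem : (x - z.2 • z.1, z.1) ∈ tsupport Ψ := subset_tsupport _ hΨ
    have h0 : z.1 ≠ 0 := Ψ.tsupport_subset hmem
    refine ⟨(x, (x - z.2 • z.1, z.1)), ⟨Metric.ball_subset_closedBall hx, hmem⟩, ?_⟩
    have h1 : ‖z.1‖ ^ 2 ≠ 0 := pow_ne_zero _ (norm_ne_zero_iff.2 h0)
    refine Prod.ext rfl ?_
    simp only [g, sub_sub_cancel, real_inner_smul_left, real_inner_self_eq_norm_sq]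
    field_simp

theorem integrable_adjointIntegrand {n p : ℕ} (k : ℕ) (i : Fin p → Fin n) (Ψ : PhaseTest n)
    (x : Space n) :
    MeasureTheory.Integrable (fun z : Space n × ℝ => adjointIntegrand k i Ψ x z.1 z.2) := by
  obtain ⟨K, hK, h⟩ := exists_compact_adjointIntegrand k i Ψ (‖x‖ + 1)
  refine Continuous.integrable_of_hasCompactSupport ?_ ?_
  · exact (contDiff_adjointIntegrand k i Ψ).continuous.comp (Continuous.prodMk_right x)
  · exact HasCompactSupport.intro hK fun z hz => h x (by simp) z hz

theorem adjointFun_eq_integral_prod {n p : ℕ} (k : ℕ) (i : Fin p → Fin n) (Ψ : PhaseTest n)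
    (x : Space n) :
    adjointFun k i Ψ x = ∫ z : Space n × ℝ, adjointIntegrand k i Ψ x z.1 z.2 :=
  (MeasureTheory.integral_prod _ (integrable_adjointIntegrand k i Ψ x)).symm

theorem contDiff_adjointFun {n p : ℕ} (k : ℕ) (i : Fin p → Fin n) (Ψ : PhaseTest n) :
    ContDiff ℝ ∞ (adjointFun k i Ψ) := by
  rw [contDiff_iff_contDiffAt]
  intro x
  obtain ⟨K, hK, h⟩ := exists_compact_adjointIntegrand k i Ψ (‖x‖ + 1)
  have key := MeasureTheory.contDiffOn_convolution_right_with_param_comp (𝕜 := ℝ) (n := ⊤)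
    (μ := (MeasureTheory.volume : MeasureTheory.Measure (Space n × ℝ)))
    (ContinuousLinearMap.lsmul ℝ ℝ : ℝ →L[ℝ] ℂ →L[ℝ] ℂ)
    (s := Metric.ball (0 : Space n) (‖x‖ + 1)) (v := fun _ => (0 : Space n × ℝ))
    contDiffOn_const (f := fun _ => (1 : ℝ))
    (g := fun y z => adjointIntegrand k i Ψ y (-z).1 (-z).2) (k := -K)
    Metric.isOpen_ball hK.neg
    (fun y z hy hz => h y hy (-z) (by simpa using hz))
    (MeasureTheory.locallyIntegrable_const _)
    (((contDiff_adjointIntegrand k i Ψ).comp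
      (contDiff_fst.prodMk contDiff_snd.neg)).contDiffOn)
  have heq : adjointFun k i Ψ = fun y : Space n => MeasureTheory.convolution
      (fun _ : Space n × ℝ => (1 : ℝ))
      (fun z : Space n × ℝ => adjointIntegrand k i Ψ y (-z).1 (-z).2)
      (ContinuousLinearMap.lsmul ℝ ℝ : ℝ →L[ℝ] ℂ →L[ℝ] ℂ) MeasureTheory.volume 0 := by
    funext y
    rw [adjointFun_eq_integral_prod, MeasureTheory.convolution]
    simp
  rw [heq]
  exact key.contDiffAt (Metric.isOpen_ball.mem_nhds (by simp))

/-- The `(i₁,…,i_p)` component of the adjoint `(I^k)^*`, as a linear map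
`C_c^∞(ℝⁿ × (ℝⁿ ∖ {0})) → C^∞(ℝⁿ)`. -/
def adjoint {n p : ℕ} (k : ℕ) (i : Fin p → Fin n) : PhaseTest n →ₗ[ℂ] SmoothFun n where
  toFun Ψ := ⟨adjointFun k i Ψ, contDiff_adjointFun k i Ψ⟩
  map_add' Ψ Φ := by
    apply Subtype.ext
    funext x
    simp only [Submodule.coe_add, Pi.add_apply, adjointFun_eq_integral_prod]
    rw [← MeasureTheory.integral_add (integrable_adjointIntegrand k i Ψ x)
      (integrable_adjointIntegrand k i Φ x)]
    simp [adjointIntegrand, mul_add]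
  map_smul' c Ψ := by
    apply Subtype.ext
    funext x
    simp only [Submodule.coe_smul, Pi.smul_apply, adjointFun_eq_integral_prod, RingHom.id_apply]
    rw [← MeasureTheory.integral_smul]
    simp [adjointIntegrand, mul_left_comm]

/-- The momentum ray transform `I^k f` of `f ∈ 𝓔'(S^p)`, as a linear functional on
`C_c^∞(ℝⁿ × (ℝⁿ ∖ {0}))`: `⟨I^k f, Ψ⟩ = ⟨f, (I^k)^* Ψ⟩ = ∑_{i₁,…,i_p} ⟨f_{i₁…i_p}, [(I^k)^* Ψ]_{i₁…i_p}⟩`. -/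
def tensorMRT {n p : ℕ} (k : ℕ) (f : SymTensorDistribution n p) : PhaseTest n →ₗ[ℂ] ℂ :=
  ∑ i : Fin p → Fin n, (f.1 i).1 ∘ₗ adjoint k i

/-- The momentum ray transform `I^{m,k} F = ∑_{p=0}^m I^k f^(p)` of `F ∈ 𝓔'(𝐒^m)`, as a linear
functional on `C_c^∞(ℝⁿ × (ℝⁿ ∖ {0}))`. -/
def MRT {n m : ℕ} (k : ℕ) (F : MixedTensorDistribution n m) : PhaseTest n →ₗ[ℂ] ℂ :=
  ∑ p : Fin (m + 1), tensorMRT k (F p)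

end MomentumRay

end

/-!
For `ξ ≠ 0` let `f^(p)(ξ)` be the contraction of `f^(p)` with `ξ ⊗ ⋯ ⊗ ξ`. If `A` is a skew linear
map, then `⟨x, A ξ⟩` is constant along each line `x + ℝ ξ`, so testing `I^{m,k} F = 0` on plane
waves with frequency `A ξ`, localised in `ξ` and `s = ⟨y, ξ⟩`, yields
`∑ p, f^(p)(ξ) ((⟨x, ξ⟩ - s) ^ k exp (i ⟨x, η⟩)) = 0` for all `s` and all `η = A ξ`, that is, for
all `η` orthogonal to `ξ`. Comparing coefficients in `s`, and then in `r` after replacing `ξ` by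
`r ξ`, gives `f^(p)(ξ) (⟨x, ξ⟩ ^ j exp (i ⟨x, η⟩)) = 0` for every `p` and every `j ≤ k`.

These are the Taylor coefficients at `r = 0` of `f^(p)(ξ)` applied to `exp (i ⟨x, η + r ξ⟩)`, so for
fixed `η` the Fourier transform of `f^(p)(ξ)` at `η` vanishes to order `k + 1` as `ξ` approaches
the hyperplane orthogonal to `η`. Along a line through a nonzero vector of that hyperplane it is
a polynomial of degree at most `p ≤ k`, hence zero. So all contractions `f^(p)(ξ)` vanish, and
a symmetric tensor is determined by its contractions with the powers of vectors.
-/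

noncomputable section

namespace MomentumRay

open MeasureTheory Function Filter Topology

section ParametricIntegral

variable {E G Z : Type*} [NormedAddCommGroup E] [NormedSpace ℝ E] [NormedAddCommGroup G]
  [NormedSpace ℝ G] [NormedAddCommGroup Z] [NormedSpace ℝ Z] {Φ : Z → E → G}

theorem contDiff_iteratedFDeriv_uncurry (hΦ : ContDiff ℝ ∞ (uncurry Φ)) (j : ℕ) :
    ContDiff ℝ ∞ fun q : Z × E => iteratedFDeriv ℝ j (Φ q.1) q.2 := by
  induction j with
  | zero => exact (continuousMultilinearCurryFin0 ℝ E G).symm.contDiff.comp hΦ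
  | succ j ih =>
    have hfderiv := ContDiff.fderiv (𝕜 := ℝ) (m := ∞) (n := ∞)
      (f := fun (q : Z × E) y => iteratedFDeriv ℝ j (Φ q.1) y) (g := Prod.snd)
      (ih.comp ((contDiff_fst.comp contDiff_fst).prodMk contDiff_snd)) contDiff_snd (by simp)
    simp only [iteratedFDeriv_succ_eq_comp_left, comp_apply]
    exact (continuousMultilinearCurryLeftEquiv ℝ (fun _ => E) G).symm.contDiff.comp hfderiv

theorem contDiff_of_contDiff_uncurry (hΦ : ContDiff ℝ ∞ (uncurry Φ)) (z : Z) :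
    ContDiff ℝ ∞ (Φ z) :=
  hΦ.comp (contDiff_const.prodMk contDiff_id)

/-- Domination of a parametric family together with all its derivatives: on every bounded set of
`x`, each derivative `∂ₓʲ Φ z x` is bounded by an integrable function of the parameter `z`. This
is what allows differentiating `∫ z, Φ z x ∂μ` in `x` arbitrarily often. -/
def DominatedOnBounded [MeasurableSpace Z] (Φ : Z → E → G) (μ : Measure Z) : Prop :=
  ∀ (j : ℕ) (s : Set E), Bornology.IsBounded s →
    ∃ B : Z → ℝ, Integrable B μ ∧ ∀ z, ∀ x ∈ s, ‖iteratedFDeriv ℝ j (Φ z) x‖ ≤ B z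

variable [MeasurableSpace Z] {μ : Measure Z}

theorem DominatedOnBounded.integrable_iteratedFDeriv [OpensMeasurableSpace Z]
    [SecondCountableTopology Z] (hB : DominatedOnBounded Φ μ) (hΦ : ContDiff ℝ ∞ (uncurry Φ))
    (j : ℕ) (x : E) : Integrable (fun z => iteratedFDeriv ℝ j (Φ z) x) μ := by
  obtain ⟨B, hBint, hBbound⟩ := hB j {x} Bornology.isBounded_singleton
  refine hBint.mono' ?_ (ae_of_all _ fun z => hBbound z x rfl)
  exact ((contDiff_iteratedFDeriv_uncurry hΦ j).continuous.comp
    (Continuous.prodMk_left x)).aestronglyMeasurable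

theorem DominatedOnBounded.hasFDerivAt_integral_iteratedFDeriv [OpensMeasurableSpace Z]
    [SecondCountableTopology Z] (hB : DominatedOnBounded Φ μ) (hΦ : ContDiff ℝ ∞ (uncurry Φ))
    (j : ℕ) (x : E) :
    HasFDerivAt (fun y => ∫ z, iteratedFDeriv ℝ j (Φ z) y ∂μ)
      (∫ z, fderiv ℝ (iteratedFDeriv ℝ j (Φ z)) x ∂μ) x := by
  obtain ⟨B, hBint, hBbound⟩ := hB (j + 1) (Metric.ball x 1) Metric.isBounded_ball
  have hsmooth : ContDiff ℝ ∞ (uncurry fun z y => iteratedFDeriv ℝ j (Φ z) y) :=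
    contDiff_iteratedFDeriv_uncurry hΦ j
  refine hasFDerivAt_integral_of_dominated_of_fderiv_le (bound := B)
    (F := fun y z => iteratedFDeriv ℝ j (Φ z) y)
    (F' := fun y z => fderiv ℝ (iteratedFDeriv ℝ j (Φ z)) y)
    (Metric.ball_mem_nhds x one_pos) ?_ (hB.integrable_iteratedFDeriv hΦ j x) ?_ ?_ hBint ?_
  · exact .of_forall fun y => (hB.integrable_iteratedFDeriv hΦ j y).aestronglyMeasurable
  · exact (ContDiff.fderiv (𝕜 := ℝ) (m := ∞) (n := ∞) hsmooth (contDiff_const (c := x))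
      (by simp)).continuous.aestronglyMeasurable
  · exact ae_of_all _ fun z y hy => norm_fderiv_iteratedFDeriv.trans_le (hBbound z y hy)
  · exact ae_of_all _ fun z y _ => ((contDiff_of_contDiff_uncurry hsmooth z).differentiable
      (by simp) y).hasFDerivAt

theorem DominatedOnBounded.iteratedFDeriv_integral [OpensMeasurableSpace Z]
    [SecondCountableTopology Z] (hB : DominatedOnBounded Φ μ) (hΦ : ContDiff ℝ ∞ (uncurry Φ))
    (j : ℕ) :
    iteratedFDeriv ℝ j (fun x => ∫ z, Φ z x ∂μ) = fun x => ∫ z, iteratedFDeriv ℝ j (Φ z) x ∂μ := by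
  induction j with
  | zero =>
    funext x
    simp only [iteratedFDeriv_zero_eq_comp, comp_apply]
    exact ((continuousMultilinearCurryFin0 ℝ E G).symm.toContinuousLinearEquiv.integral_comp_comm
      (fun z => Φ z x)).symm
  | succ j ih =>
    funext x
    simp only [iteratedFDeriv_succ_eq_comp_left, comp_apply, ih,
      (hB.hasFDerivAt_integral_iteratedFDeriv hΦ j x).fderiv]
    exact (ContinuousLinearEquiv.integral_comp_comm (𝕜 := ℝ) (E := E →L[ℝ] E [×j]→L[ℝ] G)
      (continuousMultilinearCurryLeftEquiv ℝ (fun _ => E) G).symm.toContinuousLinearEquiv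
      (fun z => fderiv ℝ (iteratedFDeriv ℝ j (Φ z)) x)).symm

theorem DominatedOnBounded.contDiff_integral [OpensMeasurableSpace Z] [SecondCountableTopology Z]
    (hB : DominatedOnBounded Φ μ) (hΦ : ContDiff ℝ ∞ (uncurry Φ)) :
    ContDiff ℝ ∞ fun x => ∫ z, Φ z x ∂μ :=
  contDiff_of_differentiable_iteratedFDeriv fun j _ => by
    rw [hB.iteratedFDeriv_integral hΦ]
    exact fun x => (hB.hasFDerivAt_integral_iteratedFDeriv hΦ j x).differentiableAt

theorem dominatedOnBounded_of_isCompact [ProperSpace E] [OpensMeasurableSpace Z]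
    [IsFiniteMeasureOnCompacts μ] (hΦ : ContDiff ℝ ∞ (uncurry Φ)) {K : Set Z} (hK : IsCompact K)
    (hΦK : ∀ z ∉ K, Φ z = 0) : DominatedOnBounded Φ μ := by
  intro j s hs
  obtain ⟨C, hC⟩ := (hK.prod hs.isCompact_closure).exists_bound_of_continuousOn
    (contDiff_iteratedFDeriv_uncurry hΦ j).continuous.continuousOn
  refine ⟨K.indicator fun _ => C, ?_, fun z x hx => ?_⟩
  · exact (integrable_indicator_iff hK.measurableSet).2 (integrableOn_const hK.measure_lt_top.ne)
  · by_cases hz : z ∈ K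
    · simpa [hz] using hC (z, x) ⟨hz, subset_closure hx⟩
    · simp [hΦK z hz, hz]

end ParametricIntegral

theorem exists_continuousLinearMap_comp_eq {𝕜 V W : Type*} [RCLike 𝕜] [AddCommGroup V]
    [Module 𝕜 V] [NormedAddCommGroup W] [NormedSpace 𝕜 W] (j : V →ₗ[𝕜] W) (T : V →ₗ[𝕜] 𝕜)
    (C : ℝ) (hT : ∀ v, ‖T v‖ ≤ C * ‖j v‖) : ∃ l : W →L[𝕜] 𝕜, ∀ v, l (j v) = T v := by
  have hker : T ∈ j.ker.dualAnnihilator := (Submodule.mem_dualAnnihilator _).2 fun v hv =>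
    norm_le_zero_iff.1 <| by simpa [LinearMap.mem_ker.1 hv] using hT v
  rw [← LinearMap.range_dualMap_eq_dualAnnihilator_ker] at hker
  obtain ⟨g, rfl⟩ := hker
  let gRange : j.range →L[𝕜] 𝕜 := (g ∘ₗ j.range.subtype).mkContinuous C <| by
    rintro ⟨_, v, rfl⟩
    exact hT v
  obtain ⟨l, hl, -⟩ := exists_extension_norm_eq j.range gRange
  exact ⟨l, fun v => hl ⟨j v, v, rfl⟩⟩

section Distribution

variable {n : ℕ} {K : Set (Space n)} {N : ℕ}

/-- The space of jets of order `N` at a point: a `j`-linear form for every `j ≤ N`. It is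
a type of its own, and not an abbreviation, so that its only topology is that of its norm. -/
def JetSpace (n N : ℕ) : Type :=
  (j : Fin (N + 1)) → Space n [×j]→L[ℝ] ℂ

instance (n N : ℕ) : NormedAddCommGroup (JetSpace n N) :=
  inferInstanceAs (NormedAddCommGroup ((j : Fin (N + 1)) → Space n [×j]→L[ℝ] ℂ))

instance (n N : ℕ) : NormedSpace ℂ (JetSpace n N) :=
  inferInstanceAs (NormedSpace ℂ ((j : Fin (N + 1)) → Space n [×j]→L[ℝ] ℂ))

instance (n N : ℕ) : CompleteSpace (JetSpace n N) :=
  inferInstanceAs (CompleteSpace ((j : Fin (N + 1)) → Space n [×j]→L[ℝ] ℂ))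

/-- The jet of order `N` along `K` of a smooth function: all its derivatives of order at most `N`,
as one continuous function on `K`. -/
def jet (K : Set (Space n)) (N : ℕ) : SmoothFun n →ₗ[ℂ] C(K, JetSpace n N) where
  toFun φ :=
    { toFun := fun x j => iteratedFDeriv ℝ j (φ : Space n → ℂ) x
      continuous_toFun := continuous_pi fun j =>
        (ContDiff.continuous_iteratedFDeriv (n := ∞) (by exact_mod_cast le_top) φ.2).comp
          continuous_subtype_val }
  map_add' φ ψ := by
    have hφ : ContDiff ℝ ∞ (φ : Space n → ℂ) := φ.2
    have hψ : ContDiff ℝ ∞ (ψ : Space n → ℂ) := ψ.2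
    ext x : 1
    funext j
    exact iteratedFDeriv_add_apply (hφ.contDiffAt.of_le (by exact_mod_cast le_top))
      (hψ.contDiffAt.of_le (by exact_mod_cast le_top))
  map_smul' c φ := by
    have hφ : ContDiff ℝ ∞ (φ : Space n → ℂ) := φ.2
    ext x : 1
    funext j
    exact iteratedFDeriv_const_smul_apply (hφ.contDiffAt.of_le (by exact_mod_cast le_top))

theorem IsContinuousFunctional.exists_comp_jet_eq {T : SmoothFun n →ₗ[ℂ] ℂ}
    (hT : IsContinuousFunctional T) : ∃ (K : Set (Space n)) (N : ℕ) (_ : CompactSpace K)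
      (l : C(K, JetSpace n N) →L[ℂ] ℂ), ∀ φ, l (jet K N φ) = T φ := by
  obtain ⟨K, N, C, hK, -, hTC⟩ := hT
  have : CompactSpace K := isCompact_iff_compactSpace.1 hK
  refine ⟨K, N, this, exists_continuousLinearMap_comp_eq (jet K N) T C fun φ => ?_⟩
  refine hTC φ _ (norm_nonneg _) fun j hj x hx => ?_
  calc ‖iteratedFDeriv ℝ j (φ : Space n → ℂ) x‖
      ≤ ‖jet K N φ ⟨x, hx⟩‖ := norm_le_pi_norm (jet K N φ ⟨x, hx⟩) ⟨j, Nat.lt_succ_of_le hj⟩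
    _ ≤ ‖jet K N φ‖ := ContinuousMap.norm_coe_le_norm _ _

/-- A family of smooth functions which is jointly smooth in the parameter and the variable. -/
def SmoothFamily {Z : Type*} [NormedAddCommGroup Z] [NormedSpace ℝ Z] (Φ : Z → SmoothFun n) :
    Prop :=
  ContDiff ℝ ∞ (uncurry fun z => (Φ z : Space n → ℂ))

variable {Z : Type*} [NormedAddCommGroup Z] [NormedSpace ℝ Z] {Φ : Z → SmoothFun n}

theorem SmoothFamily.continuous_jet (hΦ : SmoothFamily Φ) :
    Continuous fun z => jet K N (Φ z) :=
  ContinuousMap.continuous_of_continuous_uncurry _ <| continuous_pi fun j =>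
    (contDiff_iteratedFDeriv_uncurry hΦ j).continuous.comp
      (continuous_fst.prodMk (continuous_subtype_val.comp continuous_snd))

theorem IsContinuousFunctional.continuous_apply {T : SmoothFun n →ₗ[ℂ] ℂ}
    (hT : IsContinuousFunctional T) (hΦ : SmoothFamily Φ) : Continuous fun z => T (Φ z) := by
  obtain ⟨K, N, _, l, hl⟩ := hT.exists_comp_jet_eq
  simp only [← hl]
  exact l.continuous.comp hΦ.continuous_jet

variable [MeasurableSpace Z] [OpensMeasurableSpace Z] [SecondCountableTopology Z] {μ : Measure Z}

theorem SmoothFamily.integrable_jet [CompactSpace K] (N : ℕ) (hΦ : SmoothFamily Φ)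
    (hB : DominatedOnBounded (fun z => (Φ z : Space n → ℂ)) μ) :
    Integrable (fun z => jet K N (Φ z)) μ := by
  choose B hBint hBbound using fun j => hB j K (isCompact_iff_compactSpace.2 ‹_›).isBounded
  refine (integrable_finsetSum Finset.univ fun (j : Fin (N + 1)) _ => (hBint j).norm).mono'
    hΦ.continuous_jet.aestronglyMeasurable (ae_of_all _ fun z => ?_)
  have hsum : 0 ≤ ∑ j : Fin (N + 1), ‖B j z‖ := Finset.sum_nonneg fun j _ => norm_nonneg _
  refine (ContinuousMap.norm_le _ hsum).2 fun x => (pi_norm_le_iff_of_nonneg hsum).2 fun j => ?_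
  calc ‖iteratedFDeriv ℝ j (Φ z : Space n → ℂ) x‖ ≤ B j z := hBbound j z x x.2
    _ ≤ ‖B j z‖ := le_abs_self _
    _ ≤ ∑ j : Fin (N + 1), ‖B j z‖ :=
        Finset.single_le_sum (f := fun j : Fin (N + 1) => ‖B j z‖) (fun _ _ => norm_nonneg _)
          (Finset.mem_univ j)

theorem SmoothFamily.jet_eq_integral [CompactSpace K] (hΦ : SmoothFamily Φ)
    (hB : DominatedOnBounded (fun z => (Φ z : Space n → ℂ)) μ) {φ : SmoothFun n}
    (hφ : ∀ x, (φ : Space n → ℂ) x = ∫ z, (Φ z : Space n → ℂ) x ∂μ) :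
    jet K N φ = ∫ z, jet K N (Φ z) ∂μ := by
  have hderiv (j : ℕ) (x : Space n) : iteratedFDeriv ℝ j (φ : Space n → ℂ) x =
      ∫ z, iteratedFDeriv ℝ j (Φ z : Space n → ℂ) x ∂μ := by
    rw [funext hφ, hB.iteratedFDeriv_integral hΦ]
  ext x : 1
  rw [ContinuousMap.integral_apply (hΦ.integrable_jet N hB)]
  funext j
  exact (hderiv j x).trans (eval_integral (f := fun z (j : Fin (N + 1)) =>
    iteratedFDeriv ℝ j (Φ z : Space n → ℂ) x) (fun j => hB.integrable_iteratedFDeriv hΦ j x) j).symm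

theorem IsContinuousFunctional.apply_eq_integral {T : SmoothFun n →ₗ[ℂ] ℂ}
    (hT : IsContinuousFunctional T) (hΦ : SmoothFamily Φ)
    (hB : DominatedOnBounded (fun z => (Φ z : Space n → ℂ)) μ) {φ : SmoothFun n}
    (hφ : ∀ x, (φ : Space n → ℂ) x = ∫ z, (Φ z : Space n → ℂ) x ∂μ) :
    T φ = ∫ z, T (Φ z) ∂μ := by
  obtain ⟨K, N, _, l, hl⟩ := hT.exists_comp_jet_eq
  simp only [← hl]
  rw [hΦ.jet_eq_integral hB hφ, l.integral_comp_comm (hΦ.integrable_jet N hB)]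

theorem IsContinuousFunctional.eventually_eq_of_eqOn_ball {T : SmoothFun n →ₗ[ℂ] ℂ}
    (hT : IsContinuousFunctional T) : ∀ᶠ R in atTop, ∀ φ ψ : SmoothFun n,
      Set.EqOn (φ : Space n → ℂ) ψ (Metric.ball 0 R) → T φ = T ψ := by
  obtain ⟨K, N, C, hK, -, hTC⟩ := hT
  obtain ⟨R₀, hR₀⟩ := hK.isBounded.subset_ball (0 : Space n)
  filter_upwards [eventually_ge_atTop R₀] with R hR φ ψ hφψ
  rw [← sub_eq_zero, ← map_sub, ← norm_le_zero_iff, ← mul_zero C]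
  refine hTC _ 0 le_rfl fun j _ x hx => ?_
  have hzero : ((φ - ψ : SmoothFun n) : Space n → ℂ) =ᶠ[𝓝 x] 0 :=
    (hφψ.mono (Metric.ball_subset_ball hR)).eventuallyEq_of_mem
      (Metric.isOpen_ball.mem_nhds (hR₀ hx)) |>.sub_eq
  rw [(hzero.iteratedFDeriv ℝ j).eq_of_nhds]
  simp

end Distribution

open scoped RealInnerProductSpace

attribute [fun_prop] ContDiff.inner

section PlaneWave

@[fun_prop]
theorem contDiff_complex_ofReal {r : WithTop ℕ∞} : ContDiff ℝ r ((↑) : ℝ → ℂ) :=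
  Complex.ofRealCLM.contDiff

variable {n : ℕ}

/-- The plane wave `x ↦ exp (i ⟨x, η⟩)`. -/
def wave (η : Space n) : SmoothFun n :=
  ⟨fun x => Complex.exp (⟪x, η⟫ * Complex.I),
    show ContDiff ℝ ∞ fun x : Space n => Complex.exp (⟪x, η⟫ * Complex.I) by fun_prop⟩

theorem wave_apply (η x : Space n) :
    (wave η : Space n → ℂ) x = Complex.exp (⟪x, η⟫ * Complex.I) :=
  rfl

theorem iteratedDeriv_exp_ofReal_mul_I (j : ℕ) :
    iteratedDeriv j (fun t : ℝ => Complex.exp (t * Complex.I)) =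
      fun t : ℝ => Complex.I ^ j * Complex.exp (t * Complex.I) := by
  induction j with
  | zero => simp
  | succ j ih =>
    funext t
    have hderiv := ((Complex.ofRealCLM.hasDerivAt (x := t)).mul_const Complex.I).cexp.const_mul
      (Complex.I ^ j)
    rw [iteratedDeriv_succ, ih]
    refine hderiv.deriv.trans ?_
    simp only [Complex.ofRealCLM_apply, Complex.ofReal_one]
    ring

theorem norm_iteratedFDeriv_wave_le (η : Space n) (j : ℕ) (x : Space n) :
    ‖iteratedFDeriv ℝ j (wave η : Space n → ℂ) x‖ ≤ ‖η‖ ^ j := by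
  have hexp : ContDiff ℝ ∞ fun t : ℝ => Complex.exp (t * Complex.I) := by fun_prop
  have hwave : (wave η : Space n → ℂ) =
      (fun t : ℝ => Complex.exp (t * Complex.I)) ∘ innerSL ℝ η := by
    funext x
    simp [wave_apply, real_inner_comm]
  rw [hwave, ContinuousLinearMap.iteratedFDeriv_comp_right _ hexp x (by exact_mod_cast le_top)]
  refine (ContinuousMultilinearMap.norm_compContinuousLinearMap_le _ _).trans_eq ?_
  simp [norm_iteratedFDeriv_eq_norm_iteratedDeriv, iteratedDeriv_exp_ofReal_mul_I,
    Complex.norm_exp_ofReal_mul_I]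

open scoped FourierTransform SchwartzMap

theorem dominatedOnBounded_schwartzMap_smul_wave (f : 𝓢(Space n, ℂ)) (c : ℝ) :
    DominatedOnBounded (fun η => ((f η • wave (c • η) : SmoothFun n) : Space n → ℂ)) volume := by
  intro j s _
  refine ⟨fun η => |c| ^ j * (‖η‖ ^ j * ‖f η‖), (f.integrable_pow_mul volume j).const_mul _,
    fun η x _ => ?_⟩
  have hwave : ContDiff ℝ ∞ (wave (c • η) : Space n → ℂ) := (wave _).2
  calc ‖iteratedFDeriv ℝ j ((f η • wave (c • η) : SmoothFun n) : Space n → ℂ) x‖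
      = ‖f η‖ * ‖iteratedFDeriv ℝ j (wave (c • η) : Space n → ℂ) x‖ := by
        rw [← norm_smul]
        congr 1
        exact iteratedFDeriv_const_smul_apply (hwave.contDiffAt.of_le (by exact_mod_cast le_top))
    _ ≤ ‖f η‖ * ‖c • η‖ ^ j := by
        gcongr
        exact norm_iteratedFDeriv_wave_le _ _ _
    _ = |c| ^ j * (‖η‖ ^ j * ‖f η‖) := by
        rw [norm_smul, mul_pow, Real.norm_eq_abs]
        ring

theorem schwartzMap_eq_integral_fourier_smul_wave (f : 𝓢(Space n, ℂ)) (x : Space n) :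
    f x = ∫ η, ((𝓕 f η • wave ((2 * Real.pi) • η) : SmoothFun n) : Space n → ℂ) x := by
  conv_lhs => rw [← FourierPair.fourierInv_fourier_eq (F := 𝓢(Space n, ℂ)) f]
  rw [SchwartzMap.fourierInv_coe, Real.fourierInv_eq']
  refine integral_congr_ae (ae_of_all _ fun η => ?_)
  change _ = 𝓕 f η * Complex.exp (⟪x, (2 * Real.pi) • η⟫ * Complex.I)
  rw [inner_smul_right, real_inner_comm]
  exact mul_comm _ _

theorem exists_schwartzMap_eqOn_ball (φ : SmoothFun n) (R : ℝ) :
    ∃ f : 𝓢(Space n, ℂ), Set.EqOn (φ : Space n → ℂ) f (Metric.ball 0 R) := by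
  have hφ : ContDiff ℝ ∞ (φ : Space n → ℂ) := φ.2
  let χ : ContDiffBump (0 : Space n) := ⟨|R| + 1, |R| + 2, by positivity, by linarith⟩
  have hsupp : HasCompactSupport fun x => (χ x : ℂ) * (φ : Space n → ℂ) x :=
    (χ.hasCompactSupport.comp_left Complex.ofReal_zero).mul_right
  have hsmooth : ContDiff ℝ ∞ fun x => (χ x : ℂ) * (φ : Space n → ℂ) x :=
    (contDiff_complex_ofReal.comp χ.contDiff).mul hφ
  refine ⟨hsupp.toSchwartzMap hsmooth, fun x hx => ?_⟩
  have hχ : χ x = 1 := χ.one_of_mem_closedBall <| Metric.mem_closedBall.2 <|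
    (Metric.mem_ball.1 hx).le.trans (by linarith [le_abs_self R])
  simp [hχ]

theorem IsContinuousFunctional.eq_zero_of_forall_wave {T : SmoothFun n →ₗ[ℂ] ℂ}
    (hT : IsContinuousFunctional T) (hwave : ∀ η, T (wave η) = 0) : T = 0 := by
  ext φ
  obtain ⟨R, hR⟩ := hT.eventually_eq_of_eqOn_ball.exists
  obtain ⟨f, hf⟩ := exists_schwartzMap_eqOn_ball φ R
  have hfamily : SmoothFamily fun η => 𝓕 f η • wave ((2 * Real.pi) • η) := by
    have hFf : ContDiff ℝ ∞ (𝓕 f : 𝓢(Space n, ℂ)) := (𝓕 f).smooth ⊤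
    change ContDiff ℝ ∞ fun q : Space n × Space n =>
      𝓕 f q.1 * Complex.exp (⟪q.2, (2 * Real.pi) • q.1⟫ * Complex.I)
    fun_prop
  calc T φ = T ⟨f, f.smooth ⊤⟩ := hR _ _ hf
    _ = ∫ η, T (𝓕 f η • wave ((2 * Real.pi) • η)) :=
        hT.apply_eq_integral hfamily (dominatedOnBounded_schwartzMap_smul_wave _ _)
          (schwartzMap_eq_integral_fourier_smul_wave f)
    _ = 0 := by simp [hwave]

end PlaneWave

section Test

variable {n m p k : ℕ}

/-- The mode `x ↦ (⟨x, ξ⟩ - s) ^ j exp (i ⟨x, η⟩)`. -/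
def mode (j : ℕ) (ξ : Space n) (s : ℝ) (η : Space n) : SmoothFun n :=
  ⟨fun x => ((⟪x, ξ⟫ - s : ℝ) : ℂ) ^ j * (wave η : Space n → ℂ) x,
    show ContDiff ℝ ∞ fun x : Space n =>
      ((⟪x, ξ⟫ - s : ℝ) : ℂ) ^ j * Complex.exp (⟪x, η⟫ * Complex.I) by fun_prop⟩

theorem mode_apply (j : ℕ) (ξ : Space n) (s : ℝ) (η x : Space n) :
    (mode j ξ s η : Space n → ℂ) x =
      ((⟪x, ξ⟫ - s : ℝ) : ℂ) ^ j * Complex.exp (⟪x, η⟫ * Complex.I) :=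
  rfl

theorem smoothFamily_mode (j : ℕ) {Z : Type*} [NormedAddCommGroup Z] [NormedSpace ℝ Z]
    {ξ η : Z → Space n} {s : Z → ℝ} (hξ : ContDiff ℝ ∞ ξ) (hs : ContDiff ℝ ∞ s)
    (hη : ContDiff ℝ ∞ η) : SmoothFamily fun z => mode j (ξ z) (s z) (η z) := by
  change ContDiff ℝ ∞ fun q : Z × Space n =>
    ((⟪q.2, ξ q.1⟫ - s q.1 : ℝ) : ℂ) ^ j * Complex.exp (⟪q.2, η q.1⟫ * Complex.I)
  fun_prop

/-- The contraction `⟨f, ξ ⊗ ⋯ ⊗ ξ⟩ = ∑ ξ^{i₁} ⋯ ξ^{i_p} f_{i₁…i_p}` of a tensor field distribution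
with powers of a constant vector `ξ`. -/
def contract (f : SymTensorDistribution n p) (ξ : Space n) : CompactDistribution n :=
  ∑ i : Fin p → Fin n, ((∏ j, ξ (i j) : ℝ) : ℂ) • f.1 i

theorem contract_apply (f : SymTensorDistribution n p) (ξ : Space n) (φ : SmoothFun n) :
    (contract f ξ).1 φ = ∑ i : Fin p → Fin n, ((∏ j, ξ (i j) : ℝ) : ℂ) * (f.1 i).1 φ := by
  simp [contract]

theorem SmoothFamily.continuous_contract_apply {Z : Type*} [NormedAddCommGroup Z]
    [NormedSpace ℝ Z] {Φ : Z → SmoothFun n} (hΦ : SmoothFamily Φ) {ξ : Z → Space n}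
    (hξ : Continuous ξ) (f : SymTensorDistribution n p) :
    Continuous fun z => (contract f (ξ z)).1 (Φ z) := by
  simp only [contract_apply]
  have happly (i : Fin p → Fin n) : Continuous fun z => (f.1 i).1 (Φ z) :=
    (f.1 i).2.continuous_apply hΦ
  fun_prop

theorem MRT_apply (F : MixedTensorDistribution n m) (Ψ : PhaseTest n) :
    MRT k F Ψ = ∑ p, ∑ i, ((F p).1 i).1 (adjoint k i Ψ) := by
  simp [MRT, tensorMRT]

/-- Pairs `(ξ, s)` with `ξ ≠ 0`, parametrizing the hyperplanes `⟨x, ξ⟩ = s`. -/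
def HyperplaneSpace (n : ℕ) : TopologicalSpace.Opens (Space n × ℝ) where
  carrier := {z | z.1 ≠ 0}
  is_open' := isOpen_ne_fun continuous_fst continuous_const

/-- The test function `χ(y) w(ξ, ⟨y, ξ⟩) ‖ξ‖ ^ (2k + 2) exp (i ⟨y, A ξ⟩)`. For skew `A` the last
factor is constant along the line `y + ℝ ξ`; the power of `‖ξ‖` absorbs the factors produced by
the substitution `s = ⟨y, ξ⟩` on that line. -/
def waveTest (k : ℕ) (A : Space n →L[ℝ] Space n) (χ : ContDiffBump (0 : Space n))
    (w : TestFunction (HyperplaneSpace n) ℝ ⊤) : PhaseTest n where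
  toFun q := ((χ q.1 * w (q.2, ⟪q.1, q.2⟫) * (‖q.2‖ ^ 2) ^ (k + 1) : ℝ) : ℂ) *
    Complex.exp (⟪q.1, A q.2⟫ * Complex.I)
  contDiff' := by
    have hχ : ContDiff ℝ ∞ χ := χ.contDiff
    have hw : ContDiff ℝ ∞ w := w.contDiff
    have hnorm : ContDiff ℝ ∞ fun q : Space n × Space n => ‖q.2‖ ^ 2 := contDiff_snd.norm_sq ℝ
    change ContDiff ℝ ∞ _
    fun_prop
  hasCompactSupport' := by
    refine HasCompactSupport.intro (K := Metric.closedBall 0 χ.rOut ×ˢ (Prod.fst '' tsupport w))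
      ((isCompact_closedBall _ _).prod (w.hasCompactSupport.image continuous_fst)) fun q hq => ?_
    by_contra hne
    refine hq ⟨?_, (q.2, ⟪q.1, q.2⟫), subset_tsupport _ fun hw => hne (by simp [hw]), rfl⟩
    rw [← χ.tsupport_eq]
    exact subset_tsupport _ fun hχ => hne (by simp [hχ])
  tsupport_subset' := by
    have hclosed : IsClosed (Prod.snd ⁻¹' (Prod.fst '' tsupport w) : Set (Space n × Space n)) :=
      (w.hasCompactSupport.image continuous_fst).isClosed.preimage continuous_snd
    refine (closure_minimal (fun q hq => ?_) hclosed).trans ?_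
    · exact ⟨(q.2, ⟪q.1, q.2⟫), subset_tsupport _ fun hw => hq (by simp [hw]), rfl⟩
    · rintro ⟨y, _⟩ ⟨z, hz, rfl⟩
      exact w.tsupport_subset hz

theorem waveTest_apply (A : Space n →L[ℝ] Space n) (χ : ContDiffBump (0 : Space n))
    (w : TestFunction (HyperplaneSpace n) ℝ ⊤) (y ξ : Space n) :
    waveTest k A χ w (y, ξ) =
      ((χ y * w (ξ, ⟪y, ξ⟫) * (‖ξ‖ ^ 2) ^ (k + 1) : ℝ) : ℂ) * Complex.exp (⟪y, A ξ⟫ * Complex.I) :=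
  rfl

theorem ne_zero_of_testFunction_ne_zero (w : TestFunction (HyperplaneSpace n) ℝ ⊤)
    {z : Space n × ℝ} (hz : w z ≠ 0) : z.1 ≠ 0 :=
  w.tsupport_subset (subset_tsupport _ hz)

theorem inner_sub_smul_self (x ξ : Space n) (t : ℝ) :
    ⟪x - t • ξ, ξ⟫ = ⟪x, ξ⟫ - ‖ξ‖ ^ 2 * t := by
  rw [inner_sub_left, real_inner_smul_left, real_inner_self_eq_norm_sq, mul_comm]

theorem exists_contDiffBump_eq_one (w : TestFunction (HyperplaneSpace n) ℝ ⊤) (R : ℝ) :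
    ∃ χ : ContDiffBump (0 : Space n), ∀ x ∈ Metric.ball (0 : Space n) R, ∀ (ξ : Space n) (t : ℝ),
      w (ξ, ⟪x - t • ξ, ξ⟫) ≠ 0 → χ (x - t • ξ) = 1 := by
  let foot (q : Space n × (Space n × ℝ)) : Space n :=
    q.1 - ((⟪q.1, q.2.1⟫ - q.2.2) / ‖q.2.1‖ ^ 2) • q.2.1
  have hfoot : ContinuousOn foot (Metric.closedBall 0 R ×ˢ tsupport w) := by
    have hne : ∀ q ∈ Metric.closedBall (0 : Space n) R ×ˢ tsupport w, ‖q.2.1‖ ^ 2 ≠ 0 :=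
      fun q hq => pow_ne_zero 2 (norm_ne_zero_iff.2 (w.tsupport_subset hq.2))
    fun_prop (disch := assumption)
  obtain ⟨ρ, hρ⟩ := ((isCompact_closedBall (0 : Space n) R).prod
    w.hasCompactSupport).exists_bound_of_continuousOn hfoot
  refine ⟨⟨|ρ| + 1, |ρ| + 2, by positivity, by linarith⟩, fun x hx ξ t hw => ?_⟩
  have hξ : ‖ξ‖ ^ 2 ≠ 0 :=
    pow_ne_zero 2 (norm_ne_zero_iff.2 (ne_zero_of_testFunction_ne_zero w hw))
  have hfoot_eq : foot (x, (ξ, ⟪x - t • ξ, ξ⟫)) = x - t • ξ := by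
    simp only [foot, inner_sub_smul_self, sub_sub_cancel, mul_div_cancel_left₀ t hξ]
  refine ContDiffBump.one_of_mem_closedBall _ (mem_closedBall_zero_iff.2 ?_)
  calc ‖x - t • ξ‖ ≤ ρ := hfoot_eq ▸ hρ _ ⟨Metric.ball_subset_closedBall hx, subset_tsupport _ hw⟩
    _ ≤ |ρ| + 1 := by linarith [le_abs_self ρ]

theorem integral_abs_smul_comp_sub_mul {E : Type*} [NormedAddCommGroup E] [NormedSpace ℝ E]
    (h : ℝ → E) (a : ℝ) {b : ℝ} (hb : b ≠ 0) : ∫ t, |b| • h (a - b * t) = ∫ s, h s := by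
  rw [integral_smul, Measure.integral_comp_mul_left (fun s => h (a - s)) b,
    integral_sub_left_eq_self h volume a, abs_inv, smul_inv_smul₀ (abs_ne_zero.2 hb)]

theorem adjointIntegrand_waveTest (i : Fin p → Fin n) {A : Space n →L[ℝ] Space n}
    (hA : ∀ v, ⟪v, A v⟫ = 0) {χ : ContDiffBump (0 : Space n)}
    {w : TestFunction (HyperplaneSpace n) ℝ ⊤} {x ξ : Space n} {t : ℝ}
    (hχ : w (ξ, ⟪x - t • ξ, ξ⟫) ≠ 0 → χ (x - t • ξ) = 1) :
    adjointIntegrand k i (waveTest k A χ w) x ξ t = |‖ξ‖ ^ 2| •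
      (((w (ξ, ⟪x, ξ⟫ - ‖ξ‖ ^ 2 * t) * ∏ j, ξ (i j) : ℝ) : ℂ) *
        (mode k ξ (⟪x, ξ⟫ - ‖ξ‖ ^ 2 * t) (A ξ) : Space n → ℂ) x) := by
  have hphase : ⟪x - t • ξ, A ξ⟫ = ⟪x, A ξ⟫ := by
    rw [inner_sub_left, real_inner_smul_left, hA, mul_zero, sub_zero]
  rw [inner_sub_smul_self] at hχ
  rw [adjointIntegrand, waveTest_apply, mode_apply, hphase, inner_sub_smul_self, sub_sub_cancel,
    abs_sq, Complex.real_smul]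
  by_cases hw : w (ξ, ⟪x, ξ⟫ - ‖ξ‖ ^ 2 * t) = 0
  · simp [hw]
  · rw [hχ hw]
    push_cast
    ring

/-- The family of modes with frequency `A ξ`, weighted by `w(ξ, s) ξ^{i₁} ⋯ ξ^{i_p}`. -/
def weightedMode (k : ℕ) (i : Fin p → Fin n) (A : Space n →L[ℝ] Space n)
    (w : TestFunction (HyperplaneSpace n) ℝ ⊤) (z : Space n × ℝ) : SmoothFun n :=
  ((w z * ∏ j, z.1 (i j) : ℝ) : ℂ) • mode k z.1 z.2 (A z.1)

theorem smoothFamily_weightedMode (i : Fin p → Fin n) (A : Space n →L[ℝ] Space n)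
    (w : TestFunction (HyperplaneSpace n) ℝ ⊤) : SmoothFamily (weightedMode k i A w) := by
  have hw : ContDiff ℝ ∞ w := w.contDiff
  have hprod : ContDiff ℝ ∞ fun z : Space n × ℝ => ∏ j, z.1 (i j) :=
    contDiff_prod fun j _ => by fun_prop
  have hmode : SmoothFamily fun z : Space n × ℝ => mode k z.1 z.2 (A z.1) :=
    smoothFamily_mode k contDiff_fst contDiff_snd (A.contDiff.comp contDiff_fst)
  exact (contDiff_complex_ofReal.comp ((hw.mul hprod).comp contDiff_fst)).mul hmode

theorem weightedMode_eq_zero (i : Fin p → Fin n) (A : Space n →L[ℝ] Space n)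
    {w : TestFunction (HyperplaneSpace n) ℝ ⊤} {z : Space n × ℝ} (hz : z ∉ tsupport w) :
    weightedMode k i A w z = 0 := by
  simp [weightedMode, image_eq_zero_of_notMem_tsupport hz]

theorem dominatedOnBounded_weightedMode (i : Fin p → Fin n) (A : Space n →L[ℝ] Space n)
    (w : TestFunction (HyperplaneSpace n) ℝ ⊤) :
    DominatedOnBounded (fun z => (weightedMode k i A w z : Space n → ℂ)) volume :=
  dominatedOnBounded_of_isCompact (smoothFamily_weightedMode i A w) w.hasCompactSupport
    fun _ hz => congrArg Subtype.val (weightedMode_eq_zero i A hz)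

theorem adjointFun_waveTest (i : Fin p → Fin n) {A : Space n →L[ℝ] Space n}
    (hA : ∀ v, ⟪v, A v⟫ = 0) {χ : ContDiffBump (0 : Space n)}
    {w : TestFunction (HyperplaneSpace n) ℝ ⊤} {x : Space n}
    (hχ : ∀ (ξ : Space n) (t : ℝ), w (ξ, ⟪x - t • ξ, ξ⟫) ≠ 0 → χ (x - t • ξ) = 1) :
    adjointFun k i (waveTest k A χ w) x = ∫ z, (weightedMode k i A w z : Space n → ℂ) x := by
  have hint : Integrable fun z => (weightedMode k i A w z : Space n → ℂ) x :=
    Continuous.integrable_of_hasCompactSupport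
      ((smoothFamily_weightedMode i A w).continuous.comp (Continuous.prodMk_left x))
      (HasCompactSupport.intro w.hasCompactSupport fun z hz => by
        rw [weightedMode_eq_zero i A hz]; rfl)
  rw [adjointFun, Measure.volume_eq_prod, integral_prod _ hint]
  congr 1 with ξ
  by_cases hξ : ξ = 0
  · have hw (s : ℝ) : w (ξ, s) = 0 := by
      by_contra hne
      exact ne_zero_of_testFunction_ne_zero w hne hξ
    simp [adjointIntegrand, waveTest_apply, weightedMode, hw]
  · simp only [adjointIntegrand_waveTest i hA (hχ ξ _)]
    exact integral_abs_smul_comp_sub_mul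
      (fun s => (weightedMode k i A w (ξ, s) : Space n → ℂ) x) ⟪x, ξ⟫
      (pow_ne_zero 2 (norm_ne_zero_iff.2 hξ))

theorem IsContinuousFunctional.eventually_apply_adjoint_waveTest {T : SmoothFun n →ₗ[ℂ] ℂ}
    (hT : IsContinuousFunctional T) (i : Fin p → Fin n) {A : Space n →L[ℝ] Space n}
    (hA : ∀ v, ⟪v, A v⟫ = 0) (w : TestFunction (HyperplaneSpace n) ℝ ⊤) :
    ∀ᶠ R in atTop, ∀ χ : ContDiffBump (0 : Space n),
      (∀ x ∈ Metric.ball (0 : Space n) R, ∀ (ξ : Space n) (t : ℝ),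
        w (ξ, ⟪x - t • ξ, ξ⟫) ≠ 0 → χ (x - t • ξ) = 1) →
      T (adjoint k i (waveTest k A χ w)) = ∫ z, T (weightedMode k i A w z) := by
  filter_upwards [hT.eventually_eq_of_eqOn_ball] with R hR χ hχ
  have hfamily := smoothFamily_weightedMode (k := k) i A w
  have hdom := dominatedOnBounded_weightedMode (k := k) i A w
  let average : SmoothFun n :=
    ⟨fun x => ∫ z, (weightedMode k i A w z : Space n → ℂ) x, hdom.contDiff_integral hfamily⟩
  calc T (adjoint k i (waveTest k A χ w)) = T average :=
        hR _ _ fun x hx => adjointFun_waveTest i hA (hχ x hx)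
    _ = ∫ z, T (weightedMode k i A w z) := hT.apply_eq_integral hfamily hdom fun _ => rfl

theorem exists_MRT_waveTest_eq_integral (k : ℕ) (F : MixedTensorDistribution n m)
    {A : Space n →L[ℝ] Space n} (hA : ∀ v, ⟪v, A v⟫ = 0)
    (w : TestFunction (HyperplaneSpace n) ℝ ⊤) : ∃ χ : ContDiffBump (0 : Space n),
      MRT k F (waveTest k A χ w) =
        ∫ z, w z • ∑ p, (contract (F p) z.1).1 (mode k z.1 z.2 (A z.1)) := by
  obtain ⟨R, hR⟩ := (eventually_all.2 fun p => eventually_all.2 fun i =>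
    ((F p).1 i).2.eventually_apply_adjoint_waveTest (k := k) i hA w).exists
  obtain ⟨χ, hχ⟩ := exists_contDiffBump_eq_one w R
  have hint (p : Fin (m + 1)) (i : Fin p → Fin n) :
      Integrable fun z => ((F p).1 i).1 (weightedMode k i A w z) :=
    (((F p).1 i).2.continuous_apply
      (smoothFamily_weightedMode i A w)).integrable_of_hasCompactSupport
      (HasCompactSupport.intro w.hasCompactSupport fun z hz => by
        rw [weightedMode_eq_zero i A hz, map_zero])
  refine ⟨χ, ?_⟩
  calc MRT k F (waveTest k A χ w)
      = ∑ p, ∑ i, ∫ z, ((F p).1 i).1 (weightedMode k i A w z) := by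
        simp only [MRT_apply, hR _ _ χ hχ]
    _ = ∫ z, ∑ p, ∑ i, ((F p).1 i).1 (weightedMode k i A w z) := by
        rw [integral_finsetSum _ fun p _ => integrable_finsetSum _ fun i _ => hint p i]
        simp only [integral_finsetSum _ fun i _ => hint _ i]
    _ = ∫ z, w z • ∑ p, (contract (F p) z.1).1 (mode k z.1 z.2 (A z.1)) := by
        simp only [weightedMode, contract_apply, map_smul, smul_eq_mul, Complex.real_smul,
          Complex.ofReal_mul, Finset.mul_sum, mul_assoc]

theorem sum_contract_mode_eq_zero {F : MixedTensorDistribution n m} (hF : MRT k F = 0)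
    {A : Space n →L[ℝ] Space n} (hA : ∀ v, ⟪v, A v⟫ = 0) {ξ : Space n} (hξ : ξ ≠ 0) (s : ℝ) :
    ∑ p, (contract (F p) ξ).1 (mode k ξ s (A ξ)) = 0 := by
  let G (z : Space n × ℝ) : ℂ := ∑ p, (contract (F p) z.1).1 (mode k z.1 z.2 (A z.1))
  have hmode : SmoothFamily fun z : Space n × ℝ => mode k z.1 z.2 (A z.1) :=
    smoothFamily_mode k contDiff_fst contDiff_snd (A.contDiff.comp contDiff_fst)
  have hG : Continuous G := continuous_finsetSum _ fun p _ =>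
    hmode.continuous_contract_apply continuous_fst (F p)
  have hopen : IsOpen (HyperplaneSpace n : Set (Space n × ℝ)) := (HyperplaneSpace n).isOpen
  have hint (w : Space n × ℝ → ℝ) (hw : ContDiff ℝ ∞ w) (hwc : HasCompactSupport w)
      (hwU : tsupport w ⊆ HyperplaneSpace n) : ∫ z, w z • G z = 0 := by
    obtain ⟨χ, hχ⟩ := exists_MRT_waveTest_eq_integral k F hA ⟨w, hw, hwc, hwU⟩
    rw [hF] at hχ
    exact hχ.symm
  have hae := hopen.ae_eq_zero_of_integral_contDiff_smul_eq_zero (μ := volume)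
    (hG.locallyIntegrable.locallyIntegrableOn _) hint
  have hzero : ∀ z ∈ HyperplaneSpace n, G z = 0 := fun z hz =>
    Measure.eqOn_open_of_ae_eq ((ae_restrict_iff' hopen.measurableSet).2 hae) hopen
      hG.continuousOn continuousOn_const hz
  exact hzero (ξ, s) hξ

end Test

section CoefficientExtraction

variable {n m p k : ℕ}

theorem eq_zero_of_forall_sum_ofReal_pow_mul_eq_zero {N : ℕ} {c : Fin N → ℂ}
    (hc : ∀ r : ℝ, r ≠ 0 → ∑ j : Fin N, (r : ℂ) ^ (j : ℕ) * c j = 0) : c = 0 := by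
  refine Matrix.eq_zero_of_forall_index_sum_pow_mul_eq_zero
    (f := fun j : Fin N => ((((j : ℕ) + 1 : ℕ) : ℝ) : ℂ)) (fun i j hij => ?_)
    fun j => hc _ (Nat.cast_ne_zero.2 j.1.succ_ne_zero)
  simpa [Fin.ext_iff] using hij

theorem mode_eq_sum (k : ℕ) (ξ : Space n) (s : ℝ) (η : Space n) :
    mode k ξ s η = ∑ j : Fin (k + 1),
      ((s : ℂ) ^ (j : ℕ) * ((-1) ^ (j : ℕ) * k.choose j)) • mode (k - j) ξ 0 η := by
  rw [← Finset.sum_range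
    fun j => ((s : ℂ) ^ j * ((-1) ^ j * k.choose j)) • mode (k - j) ξ 0 η]
  ext x
  simp only [mode_apply, AddSubmonoidClass.coe_finsetSum, Finset.sum_apply, Submodule.coe_smul,
    Pi.smul_apply, smul_eq_mul, sub_zero, Complex.ofReal_sub]
  rw [sub_eq_neg_add, add_pow, Finset.sum_mul]
  refine Finset.sum_congr rfl fun j _ => ?_
  rw [neg_pow]
  ring

theorem mode_smul_zero (j : ℕ) (r : ℝ) (ξ η : Space n) :
    mode j (r • ξ) 0 η = (r : ℂ) ^ j • mode j ξ 0 η := by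
  ext x
  simp only [mode_apply, Submodule.coe_smul, Pi.smul_apply, smul_eq_mul, real_inner_smul_right,
    sub_zero, Complex.ofReal_mul, mul_pow, mul_assoc]

theorem contract_smul (f : SymTensorDistribution n p) (r : ℝ) (ξ : Space n) :
    contract f (r • ξ) = (r : ℂ) ^ p • contract f ξ := by
  simp [contract, Finset.prod_mul_distrib, Finset.smul_sum, smul_smul]

theorem exists_skew_apply_eq {E : Type*} [NormedAddCommGroup E] [InnerProductSpace ℝ E] {ξ η : E}
    (hξ : ξ ≠ 0) (hξη : ⟪ξ, η⟫ = 0) : ∃ A : E →L[ℝ] E, (∀ v, ⟪v, A v⟫ = 0) ∧ A ξ = η := by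
  refine ⟨(‖ξ‖ ^ 2)⁻¹ • ((innerSL ℝ ξ).smulRight η - (innerSL ℝ η).smulRight ξ), fun v => ?_, ?_⟩
  · simp only [smul_apply, sub_apply, ContinuousLinearMap.smulRight_apply, innerSL_apply_apply,
      inner_smul_right, inner_sub_right, real_inner_comm v]
    ring
  · have hnorm : ‖ξ‖ ^ 2 ≠ 0 := pow_ne_zero 2 (norm_ne_zero_iff.2 hξ)
    simp [real_inner_comm ξ η, hξη, smul_smul, hnorm]

theorem sum_contract_mode_zero_eq_zero {F : MixedTensorDistribution n m} (hF : MRT k F = 0)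
    {ξ η : Space n} (hξ : ξ ≠ 0) (hξη : ⟪ξ, η⟫ = 0) {j : ℕ} (hj : j ≤ k) :
    ∑ p, (contract (F p) ξ).1 (mode j ξ 0 η) = 0 := by
  obtain ⟨A, hA, rfl⟩ := exists_skew_apply_eq hξ hξη
  have hcoeff : (fun l : Fin (k + 1) => ((-1) ^ (l : ℕ) * k.choose l : ℂ) *
      ∑ p, (contract (F p) ξ).1 (mode (k - l) ξ 0 (A ξ))) = 0 := by
    refine eq_zero_of_forall_sum_ofReal_pow_mul_eq_zero fun s _ => ?_
    rw [← sum_contract_mode_eq_zero hF hA hξ s]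
    simp only [mode_eq_sum k ξ s, map_sum, map_smul, smul_eq_mul, Finset.mul_sum, mul_assoc]
    exact Finset.sum_comm
  have hkj := congrFun hcoeff ⟨k - j, by omega⟩
  simpa [Nat.sub_sub_self hj, (Nat.choose_pos (Nat.sub_le k j)).ne'] using hkj

theorem contract_mode_zero_eq_zero {F : MixedTensorDistribution n m} (hF : MRT k F = 0)
    {ξ η : Space n} (hξ : ξ ≠ 0) (hξη : ⟪ξ, η⟫ = 0) {j : ℕ} (hj : j ≤ k) (p : Fin (m + 1)) :
    (contract (F p) ξ).1 (mode j ξ 0 η) = 0 := by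
  refine congrFun (eq_zero_of_forall_sum_ofReal_pow_mul_eq_zero
    (c := fun p => (contract (F p) ξ).1 (mode j ξ 0 η)) fun r hr => ?_) p
  have hr' : (r : ℂ) ^ j ≠ 0 := pow_ne_zero j (Complex.ofReal_ne_zero.2 hr)
  have hsum := sum_contract_mode_zero_eq_zero hF (smul_ne_zero hr hξ)
    (show ⟪r • ξ, η⟫ = 0 by rw [real_inner_smul_left, hξη, mul_zero]) hj
  simp only [contract_smul, mode_smul_zero, map_smul, SetLike.val_smul, LinearMap.smul_apply,
    smul_eq_mul, ← Finset.mul_sum] at hsum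
  exact (mul_eq_zero.1 hsum).resolve_left hr'

end CoefficientExtraction

section Taylor

theorem exists_eq_sum_add_pow_mul_of_differentiable {f : ℂ → ℂ} (hf : Differentiable ℂ f) (N : ℕ) :
    ∃ (c : ℕ → ℂ) (H : ℂ → ℂ), Differentiable ℂ H ∧
      ∀ z, f z = ∑ j ∈ Finset.range N, c j * z ^ j + z ^ N * H z := by
  induction N generalizing f with
  | zero => exact ⟨0, f, hf, by simp⟩
  | succ N ih =>
    have hslope : Differentiable ℂ (dslope f 0) := by
      rwa [← differentiableOn_univ, Complex.differentiableOn_dslope univ_mem, differentiableOn_univ]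
    obtain ⟨c, H, hH, hexp⟩ := ih hslope
    refine ⟨fun j => Nat.casesOn j (f 0) c, H, hH, fun z => ?_⟩
    calc f z = f 0 + z * dslope f 0 z := by
          have hdslope := sub_smul_dslope f 0 z
          rw [sub_zero, smul_eq_mul] at hdslope
          rw [hdslope, add_sub_cancel]
      _ = ∑ j ∈ Finset.range N, c j * z ^ (j + 1) + f 0 * z ^ 0 + z ^ (N + 1) * H z := by
          rw [hexp z, mul_add, Finset.mul_sum]
          ring_nf
      _ = _ := by
          rw [Finset.sum_range_succ']
          rfl

variable {n p N : ℕ}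

theorem exists_wave_eq_sum_mode_add (n N : ℕ) :
    ∃ (c : ℕ → ℂ) (Θ : ℝ × Space n × Space n → SmoothFun n), SmoothFamily Θ ∧
      ∀ (r : ℝ) (e ζ : Space n),
      wave (ζ + r • e) =
        ∑ j ∈ Finset.range N, (c j * (r * Complex.I) ^ j) • mode j e 0 ζ +
          (r : ℂ) ^ N • Θ (r, e, ζ) := by
  obtain ⟨c, H, hH, hexp⟩ :=
    exists_eq_sum_add_pow_mul_of_differentiable Complex.differentiable_exp N
  have hH' : ContDiff ℝ ∞ H := hH.contDiff.restrict_scalars ℝ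
  let θ (q : ℝ × Space n × Space n) (x : Space n) : ℂ :=
    (⟪x, q.2.1⟫ * Complex.I) ^ N * H (q.1 * (⟪x, q.2.1⟫ * Complex.I)) *
      Complex.exp (⟪x, q.2.2⟫ * Complex.I)
  have hθ : ContDiff ℝ ∞ (uncurry θ) := by
    change ContDiff ℝ ∞ fun q : (ℝ × Space n × Space n) × Space n =>
      (⟪q.2, q.1.2.1⟫ * Complex.I) ^ N * H (q.1.1 * (⟪q.2, q.1.2.1⟫ * Complex.I)) *
        Complex.exp (⟪q.2, q.1.2.2⟫ * Complex.I)
    fun_prop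
  refine ⟨c, fun q => ⟨θ q, contDiff_of_contDiff_uncurry hθ q⟩, hθ, fun r e ζ => ?_⟩
  ext x
  have hsplit : (wave (ζ + r • e) : Space n → ℂ) x =
      Complex.exp (r * (⟪x, e⟫ * Complex.I)) * Complex.exp (⟪x, ζ⟫ * Complex.I) := by
    rw [wave_apply, ← Complex.exp_add, inner_add_right, real_inner_smul_right]
    push_cast
    ring_nf
  simp only [hsplit, hexp, mode_apply, Submodule.coe_add, AddSubmonoidClass.coe_finsetSum,
    Pi.add_apply, Finset.sum_apply, Submodule.coe_smul, Pi.smul_apply, smul_eq_mul, sub_zero,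
    add_mul, Finset.sum_mul, θ]
  congr 1
  · exact Finset.sum_congr rfl fun j _ => by ring
  · ring

theorem exists_contract_wave_add_smul_eq_pow_mul {f : SymTensorDistribution n p}
    (hf : ∀ e ζ : Space n, e ≠ 0 → ⟪e, ζ⟫ = 0 → ∀ j < N, (contract f e).1 (mode j e 0 ζ) = 0) :
    ∃ G : ℝ × Space n × Space n → ℂ, Continuous G ∧ ∀ (r : ℝ) (e ζ : Space n), e ≠ 0 →
      ⟪e, ζ⟫ = 0 → (contract f e).1 (wave (ζ + r • e)) = (r : ℂ) ^ N * G (r, e, ζ) := by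
  obtain ⟨c, Θ, hΘ, hwave⟩ := exists_wave_eq_sum_mode_add n N
  refine ⟨fun q => (contract f q.2.1).1 (Θ q),
    hΘ.continuous_contract_apply (continuous_fst.comp continuous_snd) f, fun r e ζ he horth => ?_⟩
  have hterms : ∀ j ∈ Finset.range N,
      (c j * (r * Complex.I) ^ j) * (contract f e).1 (mode j e 0 ζ) = 0 := fun j hj => by
    rw [hf e ζ he horth j (Finset.mem_range.1 hj), mul_zero]
  rw [hwave, map_add, map_sum]
  simp only [map_smul, smul_eq_mul]
  rw [Finset.sum_eq_zero hterms, zero_add]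

theorem exists_contract_wave_eq_inner_pow_mul {f : SymTensorDistribution n p}
    (hf : ∀ e ζ : Space n, e ≠ 0 → ⟪e, ζ⟫ = 0 → ∀ j < N, (contract f e).1 (mode j e 0 ζ) = 0)
    (η : Space n) : ∃ G : Space n → ℂ, ContinuousOn G {0}ᶜ ∧
      ∀ e ≠ 0, (contract f e).1 (wave η) = (⟪e, η⟫ : ℂ) ^ N * G e := by
  obtain ⟨G, hG, hwave⟩ := exists_contract_wave_add_smul_eq_pow_mul hf
  have hne : ∀ e ∈ ({0}ᶜ : Set (Space n)), ‖e‖ ^ 2 ≠ 0 := fun e he =>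
    pow_ne_zero 2 (norm_ne_zero_iff.2 he)
  have hr : ContinuousOn (fun e : Space n => ⟪e, η⟫ / ‖e‖ ^ 2) {0}ᶜ :=
    ContinuousOn.div (by fun_prop) (by fun_prop) hne
  have hinv : ContinuousOn (fun e : Space n => (((‖e‖ ^ 2 : ℝ) : ℂ) ^ N)⁻¹) {0}ᶜ :=
    ContinuousOn.inv₀ (by fun_prop) fun e he => pow_ne_zero N (Complex.ofReal_ne_zero.2 (hne e he))
  refine ⟨fun e => (((‖e‖ ^ 2 : ℝ) : ℂ) ^ N)⁻¹ *
      G (⟪e, η⟫ / ‖e‖ ^ 2, e, η - (⟪e, η⟫ / ‖e‖ ^ 2) • e),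
    hinv.mul (hG.comp_continuousOn
      (hr.prodMk (continuousOn_id.prodMk (continuousOn_const.sub (hr.smul continuousOn_id))))),
    fun e he => ?_⟩
  have horth : ⟪e, η - (⟪e, η⟫ / ‖e‖ ^ 2) • e⟫ = 0 := by
    rw [inner_sub_right, real_inner_smul_right, real_inner_self_eq_norm_sq,
      div_mul_cancel₀ _ (hne e he), sub_self]
  have hexp := hwave (⟪e, η⟫ / ‖e‖ ^ 2) e _ he horth
  rw [sub_add_cancel] at hexp
  rw [hexp, Complex.ofReal_div, div_pow, div_eq_mul_inv, mul_assoc]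

open Polynomial in
theorem X_pow_dvd_of_isBigO {P : ℂ[X]}
    (hP : (fun t : ℝ => P.eval (t : ℂ)) =O[𝓝[≠] 0] fun t => (t : ℂ) ^ N) : X ^ N ∣ P := by
  induction N generalizing P with
  | zero => simp
  | succ N ih =>
    have hpow : Tendsto (fun t : ℝ => (t : ℂ) ^ (N + 1)) (𝓝[≠] 0) (𝓝 0) :=
      Continuous.tendsto' (by fun_prop) _ _ (by simp) |>.mono_left nhdsWithin_le_nhds
    have heval : Tendsto (fun t : ℝ => P.eval (t : ℂ)) (𝓝[≠] 0) (𝓝 (P.eval 0)) :=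
      Continuous.tendsto' (by fun_prop) _ _ (by simp) |>.mono_left nhdsWithin_le_nhds
    obtain ⟨Q, rfl⟩ : X ∣ P := by
      rw [X_dvd_iff, coeff_zero_eq_eval_zero]
      exact tendsto_nhds_unique heval (hP.trans_tendsto hpow)
    rw [pow_succ']
    refine mul_dvd_mul_left X (ih ?_)
    refine ((Asymptotics.isBigO_refl (fun t : ℝ => (t : ℂ)⁻¹) _).mul hP).congr' ?_ ?_
    all_goals
      filter_upwards [self_mem_nhdsWithin] with t ht
      have ht' : (t : ℂ) ≠ 0 := Complex.ofReal_ne_zero.2 ht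
    · rw [eval_mul, eval_X, inv_mul_cancel_left₀ ht']
    · rw [pow_succ', inv_mul_cancel_left₀ ht']

open Polynomial in
theorem exists_polynomial_eval_eq_contract_line (f : SymTensorDistribution n p) (φ : SmoothFun n)
    (ξ v : Space n) : ∃ P : ℂ[X], P.natDegree ≤ p ∧
      ∀ t : ℝ, P.eval (t : ℂ) = (contract f (ξ + t • v)).1 φ := by
  refine ⟨∑ i, C ((f.1 i).1 φ) * ∏ j, (C (ξ (i j) : ℂ) + C (v (i j) : ℂ) * X), ?_, fun t => ?_⟩
  · refine natDegree_sum_le_of_forall_le _ _ fun i _ => (natDegree_C_mul_le _ _).trans ?_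
    refine (natDegree_prod_le _ _).trans
      ((Finset.sum_le_card_nsmul _ _ 1 fun j _ => ?_).trans_eq (by simp))
    compute_degree
  · rw [contract_apply, eval_finsetSum]
    refine Finset.sum_congr rfl fun i _ => ?_
    rw [eval_mul, eval_C, eval_prod, mul_comm]
    simp [mul_comm (t : ℂ)]

theorem exists_ne_zero_inner_eq_zero {E : Type*} [NormedAddCommGroup E] [InnerProductSpace ℝ E]
    (hE : 1 < Module.finrank ℝ E) (η : E) : ∃ v : E, v ≠ 0 ∧ ⟪v, η⟫ = 0 := by
  have hne : (ℝ ∙ η)ᗮ ≠ ⊥ := fun hbot => by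
    have hspan : Module.finrank ℝ (ℝ ∙ η) ≤ 1 := by
      simpa using finrank_span_le_card (R := ℝ) ({η} : Set E)
    rw [(Submodule.orthogonal_eq_bot_iff).1 hbot, finrank_top] at hspan
    omega
  obtain ⟨v, hv, hv0⟩ := Submodule.exists_mem_ne_zero_of_ne_bot hne
  exact ⟨v, hv0, Submodule.mem_orthogonal_singleton_iff_inner_left.1 hv⟩

theorem contract_eq_zero_of_forall_mode (hn : 2 ≤ n) (hp : p < N) {f : SymTensorDistribution n p}
    (hf : ∀ e ζ : Space n, e ≠ 0 → ⟪e, ζ⟫ = 0 → ∀ j < N, (contract f e).1 (mode j e 0 ζ) = 0)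
    (ξ : Space n) : contract f ξ = 0 := by
  refine Subtype.ext ((contract f ξ).2.eq_zero_of_forall_wave fun η => ?_)
  obtain ⟨ξ₀, hξ₀, horth⟩ := exists_ne_zero_inner_eq_zero (E := Space n)
    (by rwa [finrank_euclideanSpace_fin]) η
  obtain ⟨G, hG, hGeq⟩ := exists_contract_wave_eq_inner_pow_mul hf η
  obtain ⟨P, hdeg, hP⟩ := exists_polynomial_eval_eq_contract_line f (wave η) ξ₀ (ξ - ξ₀)
  have hline : Tendsto (fun t : ℝ => ξ₀ + t • (ξ - ξ₀)) (𝓝[≠] 0) (𝓝 ξ₀) :=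
    Continuous.tendsto' (by fun_prop) _ _ (by simp) |>.mono_left nhdsWithin_le_nhds
  have hGcont : ContinuousAt G ξ₀ := hG.continuousAt (isOpen_compl_singleton.mem_nhds hξ₀)
  have hBigO : (fun t : ℝ => P.eval (t : ℂ)) =O[𝓝[≠] 0] fun t => (t : ℂ) ^ N := by
    have hfactor : (fun t : ℝ => P.eval (t : ℂ)) =ᶠ[𝓝[≠] 0]
        fun t => (t : ℂ) ^ N * ((⟪ξ, η⟫ : ℂ) ^ N * G (ξ₀ + t • (ξ - ξ₀))) := by
      filter_upwards [hline.eventually_ne hξ₀] with t ht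
      rw [hP, hGeq _ ht, inner_add_left, real_inner_smul_left, inner_sub_left, horth, zero_add,
        sub_zero, Complex.ofReal_mul, mul_pow, mul_assoc]
    have hbounded : (fun t : ℝ => (⟪ξ, η⟫ : ℂ) ^ N * G (ξ₀ + t • (ξ - ξ₀))) =O[𝓝[≠] 0]
        fun _ => (1 : ℂ) :=
      ((hGcont.tendsto.comp hline).const_mul _).isBigO_one ℂ
    simpa using hfactor.trans_isBigO ((Asymptotics.isBigO_refl _ _).mul hbounded)
  have hPzero : P = 0 := Polynomial.eq_zero_of_dvd_of_natDegree_lt (X_pow_dvd_of_isBigO hBigO)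
    (by simpa using hdeg.trans_lt hp)
  simpa [hPzero] using (hP 1).symm

end Taylor

section SymmetricTensor

theorem exists_perm_of_sum_single_eq {ι κ : Type*} [Fintype ι] {f g : ι → κ}
    (h : ∑ j, Finsupp.single (f j) (1 : ℕ) = ∑ j, Finsupp.single (g j) 1) :
    ∃ σ : Equiv.Perm ι, f = g ∘ σ := by
  classical
  have hfiber (b : κ) : Nonempty ({a // f a = b} ≃ {a // g a = b}) := by
    rw [← Fintype.card_eq, Fintype.card_subtype, Fintype.card_subtype]
    simpa [Finsupp.single_apply] using DFunLike.congr_fun h b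
  let e (b : κ) := (hfiber b).some
  exact ⟨Equiv.ofFiberEquiv e, funext fun a => (Equiv.ofFiberEquiv_map e a).symm⟩

theorem eq_zero_of_forall_sum_prod_mul_eq_zero {ι κ R : Type*} [Fintype ι] [DecidableEq ι]
    [Fintype κ] [CommRing R] [IsDomain R] [CharZero R] {s : Set R} (hs : s.Infinite)
    {c : (ι → κ) → R} (hc : ∀ (σ : Equiv.Perm ι) i, c (i ∘ σ) = c i)
    (h : ∀ ξ : κ → R, (∀ k, ξ k ∈ s) → ∑ i, (∏ j, ξ (i j)) * c i = 0) : c = 0 := by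
  classical
  let d (i : ι → κ) : κ →₀ ℕ := ∑ j, Finsupp.single (i j) 1
  let P : MvPolynomial κ R := ∑ i, MvPolynomial.monomial (d i) (c i)
  have hP : P = 0 := MvPolynomial.funext_set (fun _ => s) (fun _ => hs) fun ξ hξ => by
    have hprod (i : ι → κ) : ((d i).prod fun k e => ξ k ^ e) = ∏ j, ξ (i j) := by
      simp [d, ← Finsupp.prod_finsetSum_index, pow_add]
    simpa [P, MvPolynomial.eval_monomial, hprod, mul_comm] using h ξ fun k => hξ k trivial
  have hcoeff (i : ι → κ) : P.coeff (d i) = (Finset.univ.filter (d · = d i)).card * c i := by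
    have hterm (i' : ι → κ) :
        (MvPolynomial.monomial (d i') (c i')).coeff (d i) = if d i' = d i then c i else 0 := by
      rw [MvPolynomial.coeff_monomial]
      refine ite_congr rfl (fun hd => ?_) fun _ => rfl
      obtain ⟨σ, rfl⟩ := exists_perm_of_sum_single_eq hd
      exact hc σ i
    simp only [P, MvPolynomial.coeff_sum, hterm, ← Finset.sum_filter, Finset.sum_const,
      nsmul_eq_mul]
  funext i
  have hi := hcoeff i
  rw [hP, MvPolynomial.coeff_zero, eq_comm, mul_eq_zero, Nat.cast_eq_zero] at hi
  exact hi.resolve_left (Finset.card_ne_zero.2 ⟨i, by simp⟩)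

theorem SymTensorDistribution.eq_zero_of_forall_contract_eq_zero {n p : ℕ}
    {f : SymTensorDistribution n p} (hf : ∀ ξ, contract f ξ = 0) : f = 0 := by
  have happly (φ : SmoothFun n) : (fun i => (f.1 i).1 φ) = 0 := by
    refine eq_zero_of_forall_sum_prod_mul_eq_zero (s := Set.range ((↑) : ℝ → ℂ))
      (Set.infinite_range_of_injective Complex.ofReal_injective)
      (fun σ i => by rw [f.2 σ i]) fun ξ hξ => ?_
    choose x hx using hξ
    have hcontract := contract_apply f (WithLp.toLp 2 x) φ
    simpa [hf, hx, eq_comm] using hcontract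
  ext i φ
  exact congrFun (happly φ) i

end SymmetricTensor

end MomentumRay

end

theorem mainTheorem3_general (n m k : ℕ) (hn : 2 ≤ n) (hk : m ≤ k)
    (F : MomentumRay.MixedTensorDistribution n m) (hF : MomentumRay.MRT k F = 0) : F = 0 := by
  funext p
  refine MomentumRay.SymTensorDistribution.eq_zero_of_forall_contract_eq_zero fun ξ => ?_
  have hp : (p : ℕ) < k + 1 := p.2.trans_le (Nat.succ_le_succ hk)
  exact MomentumRay.contract_eq_zero_of_forall_mode hn hp (fun e ζ he horth j hj =>
    MomentumRay.contract_mode_zero_eq_zero hF he horth (Nat.lt_succ_iff.1 hj) p) ξ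

theorem mainTheorem3 (n m : ℕ) (hn : 2 ≤ n) (F : MomentumRay.MixedTensorDistribution n m)
    (hF : MomentumRay.MRT m F = 0) : F = 0 :=
  mainTheorem3_general n m m hn le_rfl F hF
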